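/- There are absolute constants $c>0$, $C\in\mathbb N$ and $K\ge 1$ such that the following holds for all numbers $s$ of servers, dimensions $d$, precisions $L\in\mathbb N$ and accuracies $\epsilon$ with $0<\epsilon\le (s+d)^{-C}$. Consider distributed least squares regression in the coordinator model: server $i\in\{1,\dots,s\}$ holds $A^{(i)}\in\mathbb R^{n_i\times d}$ and $b^{(i)}\in\mathbb R^{n_i}$; $A$ and $b$ denote the vertical concatenations; all entries of $A$ and $b$ are of the form $k2^{-L}$ with $k\in\{-2^L+1,\dots,2^L\}$; and $\|b\|_2=1$. The servers and a central coordinator share public randomness, each server communicates only with the coordinator, every bit sent or received by the coordinator counts as communication, and at the end the coordinator outputs a vector $\widehat x\in\mathbb R^d$. Let $\kappa(A)=\|A\|_2\|A^\dagger\|_2$ denote the condition number. There are row counts $n^0_1,\dots,n^0_s$ with $\sum_i n^0_i\le (s+d)^C$ such that, for all row counts $n_i\ge n^0_i$, every randomized protocol that, on each such instance $(A,b)$ with $\kappa(A)\le K$, outputs with probability at least $0.98$ a vector $\widehat x$ with $$\|A\widehat x-b\|_2\le \epsilon+\min_{x\in\mathbb R^d}\|Ax-b\|_2$$ uses in the worst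 case (over such instances and the random bits) at least $$c\cdot s\,d\cdot\min\bigl(\log_2(\epsilon^{-1}),\,L\bigr)$$ bits of communication. In particular the bound $\Omega(sd\min(\log\epsilon^{-1},L))$ holds for protocols that must be correct on all inputs, and it persists when $A$ is promised to have condition number $O(1)$. -/

import Mathlib

/-! ### The coordinator model of communication -/

/-- One bit on the channel between the coordinator and a server: `up b` is a bit sent by the server
to the coordinator, `down b` a bit sent by the coordinator to the server. -/
inductive ChannelBit : Type
  | up (b : Bool)
  | down (b : Bool)

/-- A transcript: all bits exchanged so far, in chronological order, each tagged with the server on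
whose channel it travelled. -/
abbrev Transcript (s : ℕ) : Type := List (Fin s × ChannelBit)

/-- The part of a transcript that server `i` has seen, namely the bits on its own channel. -/
def Transcript.channel {s : ℕ} (i : Fin s) (τ : Transcript s) : List ChannelBit :=
  (τ.filter fun e => e.1 = i).map Prod.snd

/-- What the coordinator can do next: get one bit from server `i`, send the bit `b` to server `i`, or
stop and output `y`. -/
inductive CoordAction (s : ℕ) (Y : Type) : Type
  | receive (i : Fin s)
  | send (i : Fin s) (b : Bool)
  | output (y : Y)

/-- A deterministic protocol in the coordinator model with `s` servers, where server `i` holds an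
input in `X i` and the coordinator (which has no input) outputs an element of `Y`.  The coordinator
takes part in every exchange, so it acts on the whole transcript; a bit sent by server `i` depends
only on the input of that server and on the bits exchanged on its own channel. -/
structure CoordProtocol (s : ℕ) (X : Fin s → Type) (Y : Type) where
  action : Transcript s → CoordAction s Y
  reply : (i : Fin s) → X i → List ChannelBit → Bool

namespace CoordProtocol

variable {s : ℕ} {X : Fin s → Type} {Y : Type}

/-- `P.Reaches x τ`: on the inputs `x`, the transcript `τ` occurs in the course of the execution. -/
inductive Reaches (P : CoordProtocol s X Y) (x : ∀ i, X i) : Transcript s → Prop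
  | start : Reaches P x []
  | receive {τ : Transcript s} {i : Fin s} (h : Reaches P x τ) (ha : P.action τ = .receive i) :
      Reaches P x (τ ++ [(i, .up (P.reply i (x i) (τ.channel i)))])
  | send {τ : Transcript s} {i : Fin s} {b : Bool} (h : Reaches P x τ)
      (ha : P.action τ = .send i b) :
      Reaches P x (τ ++ [(i, .down b)])

/-- On the inputs `x` the execution stops and the coordinator outputs `y`. -/
def Outputs (P : CoordProtocol s X Y) (x : ∀ i, X i) (y : Y) : Prop :=
  ∃ τ, P.Reaches x τ ∧ P.action τ = .output y

/-- On the inputs `x` at most `B` bits are sent or received by the coordinator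
(in particular, the execution stops). -/
def UsesAtMost (P : CoordProtocol s X Y) (x : ∀ i, X i) (B : ℕ) : Prop :=
  ∀ τ, P.Reaches x τ → τ.length ≤ B

/-- A randomized protocol with shared randomness is a family of deterministic protocols indexed by a
probability space.  On the inputs `x`, with probability at least `p`, it outputs some `y` that
satisfies `good`. -/
def SucceedsWithProb {Ω : Type*} [MeasurableSpace Ω] (μ : MeasureTheory.Measure Ω)
    (P : Ω → CoordProtocol s X Y) (x : ∀ i, X i) (good : Y → Prop) (p : ℝ) : Prop :=
  ∃ E : Set Ω, MeasurableSet E ∧ p ≤ μ.real E ∧ ∀ ω ∈ E, ∃ y, (P ω).Outputs x y ∧ good y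

end CoordProtocol

/-! ### Distributed least squares regression -/

/-- The input of a server that holds `m` rows: its block of the matrix and of the right-hand side. -/
abbrev ServerInput (d m : ℕ) : Type := Matrix (Fin m) (Fin d) ℝ × (Fin m → ℝ)

/-- The matrix `A` obtained by stacking the blocks of all servers. -/
def stackedMatrix {s d : ℕ} {n : Fin s → ℕ} (x : ∀ i, ServerInput d (n i)) :
    Matrix (Σ i, Fin (n i)) (Fin d) ℝ :=
  Matrix.of fun r k => (x r.1).1 r.2 k

/-- The vector `b` obtained by stacking the blocks of all servers. -/
def stackedVector {s d : ℕ} {n : Fin s → ℕ} (x : ∀ i, ServerInput d (n i)) :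
    (Σ i, Fin (n i)) → ℝ :=
  fun r => (x r.1).2 r.2

/-- The Euclidean norm `‖A z - b‖`. -/
noncomputable def lsResidual {s d : ℕ} {n : Fin s → ℕ} (x : ∀ i, ServerInput d (n i))
    (z : Fin d → ℝ) : ℝ :=
  ‖WithLp.toLp 2 (Matrix.mulVec (stackedMatrix x) z - stackedVector x)‖

/-- `‖A z - b‖ ≤ ε + min_w ‖A w - b‖`. -/
def IsApproxLeastSquares {s d : ℕ} {n : Fin s → ℕ} (x : ∀ i, ServerInput d (n i)) (ε : ℝ)
    (z : Fin d → ℝ) : Prop :=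
  ∀ w : Fin d → ℝ, lsResidual x z ≤ ε + lsResidual x w

/-- The number `t` is expressed to `L` bits of precision. -/
def HasBits (L : ℕ) (t : ℝ) : Prop :=
  ∃ k : ℤ, -2 ^ L + 1 ≤ k ∧ k ≤ 2 ^ L ∧ t = k / 2 ^ L

/-- `G` is the Moore-Penrose inverse of the real matrix `A`. -/
def IsMoorePenroseInverse {ι κ : Type*} [Fintype ι] [Fintype κ] (A : Matrix ι κ ℝ)
    (G : Matrix κ ι ℝ) : Prop :=
  A * G * A = A ∧ G * A * G = G ∧ (A * G).transpose = A * G ∧ (G * A).transpose = G * A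

open scoped Matrix.Norms.L2Operator in
/-- The condition number `‖A‖ ‖A†‖` (in operator norm) is at most `K`. -/
def CondNumberLE {ι κ : Type*} [Fintype ι] [Fintype κ] [DecidableEq ι] [DecidableEq κ]
    (A : Matrix ι κ ℝ) (K : ℝ) : Prop :=
  ∃ G : Matrix κ ι ℝ, IsMoorePenroseInverse A G ∧ ‖A‖ * ‖G‖ ≤ K

/-- The instances of the regression problem: the entries of `A` and `b` are expressed to `L` bits of
precision, `‖b‖ = 1`, and `A` is promised to have condition number at most `K`. -/
structure IsRegressionInstance {s d : ℕ} {n : Fin s → ℕ} (L : ℕ) (K : ℝ)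
    (x : ∀ i, ServerInput d (n i)) : Prop where
  bits_matrix : ∀ r k, HasBits L (stackedMatrix x r k)
  bits_vector : ∀ r, HasBits L (stackedVector x r)
  norm_vector : ‖WithLp.toLp 2 (stackedVector x)‖ = 1
  cond : CondNumberLE (stackedMatrix x) K

/-! ### Counting transcripts in the coordinator model -/

/-! The servers hold numbers `t i j = k i j / 2 ^ q` in diagonal rows, together with enough identity
rows to keep the condition number at most 2; one server also holds the row of ones with right-hand
side 1. The squared residual is then `∑ Λ_j z_j² + (∑ z_j - 1)²` with `Λ_j = s d + ∑ i, t i j ^ 2`.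
An approximate minimizer has small gradient and coordinates bounded below. If one server's data
change, some `Λ_j` moves by at least `4 ^ (-q)`, which the same `z` cannot absorb when `ε` is small
(`data_eq_of_common_solution`). So the output determines each server's input once the other inputs
are known.

The rest is counting (`CoordProtocol.le_communication`). With the other inputs fixed, the bits on
channel `i` determine the whole execution (`Reaches.eq_of_channel_eq`), hence the output and then
the input of server `i`. For uniform data most inputs therefore need a long history on every
channel, and the channel lengths add up to the total. Averaging over the public randomness
(`exists_outcome_mem_many`) reduces to one deterministic protocol that is correct on 98% of the
inputs. -/

theorem Transcript.channel_append {s : ℕ} (i : Fin s) (σ τ : Transcript s) :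
    Transcript.channel i (σ ++ τ) = σ.channel i ++ τ.channel i := by
  simp [Transcript.channel]

theorem Transcript.sum_length_channel {s : ℕ} (τ : Transcript s) :
    ∑ i, (τ.channel i).length = τ.length := by
  induction τ with
  | nil => simp [Transcript.channel]
  | cons e τ ih =>
    have h : ∀ i, (Transcript.channel i (e :: τ)).length =
        (if e.1 = i then 1 else 0) + (Transcript.channel i τ).length := by
      intro i
      by_cases hi : e.1 = i
      · simp [Transcript.channel, hi, add_comm]
      · simp [Transcript.channel, hi]
    simp [h, Finset.sum_add_distrib, ih, add_comm]

namespace CoordProtocol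

variable {s : ℕ} {X : Fin s → Type} {Y : Type}

/-- Every entry of a transcript that occurs is the one dictated by the protocol. -/
theorem Reaches.entry {P : CoordProtocol s X Y} {x : ∀ i, X i} {T : Transcript s}
    (h : P.Reaches x T) (τ : Transcript s) (e : Fin s × ChannelBit) (ρ : Transcript s)
    (hT : T = τ ++ e :: ρ) :
    (∃ j, P.action τ = .receive j ∧ e = (j, .up (P.reply j (x j) (τ.channel j)))) ∨
      ∃ j b, P.action τ = .send j b ∧ e = (j, .down b) := by
  induction h generalizing ρ with
  | start => simp at hT
  | receive h ha ih =>
    rcases List.eq_nil_or_concat ρ with rfl | ⟨ρ', f, rfl⟩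
    · obtain ⟨rfl, he⟩ := List.append_inj' hT rfl
      simp only [List.cons.injEq, and_true] at he
      exact Or.inl ⟨_, ha, he.symm⟩
    · rw [List.concat_eq_append, ← List.cons_append, ← List.append_assoc] at hT
      exact ih ρ' (List.append_inj' hT rfl).1
  | send h ha ih =>
    rcases List.eq_nil_or_concat ρ with rfl | ⟨ρ', f, rfl⟩
    · obtain ⟨rfl, he⟩ := List.append_inj' hT rfl
      simp only [List.cons.injEq, and_true] at he
      exact Or.inr ⟨_, _, ha, he.symm⟩
    · rw [List.concat_eq_append, ← List.cons_append, ← List.append_assoc] at hT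
      exact ih ρ' (List.append_inj' hT rfl).1

/-- If two inputs agree except at server `i`, then what happens on channel `i` determines the
execution. -/
theorem Reaches.isPrefix_of_channel {P : CoordProtocol s X Y} {x x' : ∀ i, X i} {i : Fin s}
    (hx : ∀ j, j ≠ i → x j = x' j) {τ' : Transcript s} (h' : P.Reaches x' τ') {y : Y}
    (hy : P.action τ' = .output y) {τ : Transcript s} (h : P.Reaches x τ)
    (hc : τ.channel i <+: τ'.channel i) : τ <+: τ' := by
  induction h with
  | start => exact ⟨_, List.nil_append _⟩
  | @receive τ j h ha ih =>
    rw [Transcript.channel_append] at hc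
    obtain ⟨ρ, rfl⟩ := ih ((List.prefix_append _ _).trans hc)
    -- `τ'` cannot end here, since the protocol does not stop at `τ`. Its next entry has the same
    -- action; a reply from `j ≠ i` agrees because the inputs do, and one from `i` by `hc`.
    rcases ρ with _ | ⟨e, ρ⟩
    · simp [ha] at hy
    · rw [List.prefix_append_right_inj]
      rcases h'.entry τ e ρ rfl with ⟨j', hj', rfl⟩ | ⟨j', b, hj', rfl⟩
      · obtain rfl : j = j' := by simpa [ha] using hj'
        by_cases hji : j = i
        · subst hji
          rw [Transcript.channel_append, List.prefix_append_right_inj] at hc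
          simp [Transcript.channel] at hc
          simpa [Transcript.channel] using hc
        · simp [hx j hji]
      · simp [ha] at hj'
  | @send τ j b h ha ih =>
    rw [Transcript.channel_append] at hc
    obtain ⟨ρ, rfl⟩ := ih ((List.prefix_append _ _).trans hc)
    rcases ρ with _ | ⟨e, ρ⟩
    · simp [ha] at hy
    · rw [List.prefix_append_right_inj]
      rcases h'.entry τ e ρ rfl with ⟨j', hj', rfl⟩ | ⟨j', b', hj', rfl⟩
      · simp [ha] at hj'
      · rw [ha] at hj'
        cases hj'
        simp

theorem Reaches.eq_of_channel_eq {P : CoordProtocol s X Y} {x x' : ∀ i, X i} {i : Fin s}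
    (hx : ∀ j, j ≠ i → x j = x' j) {τ τ' : Transcript s} (h : P.Reaches x τ)
    (h' : P.Reaches x' τ') {y y' : Y} (hy : P.action τ = .output y)
    (hy' : P.action τ' = .output y') (hc : τ.channel i = τ'.channel i) : τ = τ' := by
  have h₁ := h'.isPrefix_of_channel hx hy' h (hc ▸ List.prefix_rfl)
  have h₂ := h.isPrefix_of_channel (fun j hj => (hx j hj).symm) hy h' (hc ▸ List.prefix_rfl)
  exact h₁.eq_of_length_le h₂.length_le

end CoordProtocol

/-- A channel bit as a pair of Booleans. -/
def ChannelBit.toPair : ChannelBit → Bool × Bool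
  | .up b => (true, b)
  | .down b => (false, b)

theorem ChannelBit.toPair_injective : Function.Injective ChannelBit.toPair := by
  rintro (_ | _) (_ | _) h <;> simp_all [ChannelBit.toPair]

/-- The code of a list of at most `t` channel bits. -/
def ChannelBit.encode (t : ℕ) (l : List ChannelBit) : Fin t → Option (Bool × Bool) :=
  fun n => l[(n : ℕ)]?.map ChannelBit.toPair

theorem ChannelBit.encode_injOn (t : ℕ) :
    Set.InjOn (ChannelBit.encode t) {l | l.length ≤ t} := by
  intro l hl l' hl' h
  refine List.ext_getElem? fun n => ?_
  by_cases hn : n < t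
  · exact Option.map_injective ChannelBit.toPair_injective (congrFun h ⟨n, hn⟩)
  · simp only [Set.mem_ofPred_eq] at hl hl'
    rw [List.getElem?_eq_none (by omega), List.getElem?_eq_none (by omega)]

/-- Each position of an encoded channel history takes 5 values, and `5 < 8 = 2 ^ 3`. Histories of
length at most `m / 3` thus reach only a fixed fraction, below 0.98, of `2 ^ m` inputs. -/
theorem five_pow_le (m : ℕ) (hm : 1 ≤ m) : (5 : ℝ) ^ (m / 3) ≤ 5 / 8 * 2 ^ m := by
  have key : ∀ t : ℕ, (5 : ℝ) ^ t ≤ 8 ^ t := fun t => by gcongr; norm_num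
  rcases Nat.eq_zero_or_pos (m / 3) with h | h
  · have : (2 : ℝ) ^ 1 ≤ 2 ^ m := pow_le_pow_right₀ (by norm_num) hm
    rw [h]; linarith
  · obtain ⟨t, ht⟩ : ∃ t, m / 3 = t + 1 := ⟨m / 3 - 1, by omega⟩
    have h1 : (2 : ℝ) ^ (3 * (t + 1)) ≤ 2 ^ m := pow_le_pow_right₀ (by norm_num) (by omega)
    rw [pow_mul] at h1
    norm_num at h1
    rw [ht]
    have h2 := key t
    rw [pow_succ] at h1 ⊢
    linarith

/-- Distributional lower bound for deterministic protocols: if the output determines the input of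
each server given the inputs of the others, then each server has to communicate a constant fraction
of its input. -/
theorem CoordProtocol.le_communication {s : ℕ} {X : Fin s → Type} {Y V : Type} [Fintype V]
    {m : ℕ} (hm : 1 ≤ m) (hV : Fintype.card V = 2 ^ m) (P : CoordProtocol s X Y)
    (f : ∀ i, V → X i) (good : (Fin s → V) → Y → Prop)
    (hgood : ∀ (i : Fin s) (k k' : Fin s → V), (∀ j, j ≠ i → k j = k' j) →
      ∀ y, good k y → good k' y → k = k')
    (S : Finset (Fin s → V)) (B : ℕ)
    (hS : 0.98 * (Fintype.card (Fin s → V) : ℝ) ≤ S.card)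
    (hout : ∀ k ∈ S, ∃ y, P.Outputs (fun i => f i (k i)) y ∧ good k y)
    (hB : ∀ k ∈ S, P.UsesAtMost (fun i => f i (k i)) B) :
    (s * m : ℝ) ≤ 10 * B := by
  classical
  set N : ℝ := (Fintype.card (Fin s → V) : ℝ) with hN
  have hNpos : 0 < N := by
    rw [hN, Fintype.card_fun, hV]; positivity
  have hτ : ∀ k ∈ S, ∃ τ, P.Reaches (fun i => f i (k i)) τ ∧
      ∃ y, P.action τ = .output y ∧ good k y := by
    intro k hk
    obtain ⟨y, ⟨τ, h1, h2⟩, h3⟩ := hout k hk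
    exact ⟨τ, h1, y, h2, h3⟩
  choose! τ hτ using hτ
  set t := m / 3 with ht
  -- On inputs with a short history on channel `i`, that history and the other servers' data recover
  -- `k`.
  have hshort : ∀ i, ((S.filter fun k => ((τ k).channel i).length ≤ t).card : ℝ) ≤ 5 / 8 * N := by
    intro i
    have hcard : (S.filter fun k => ((τ k).channel i).length ≤ t).card ≤
        (Finset.univ : Finset (({j // j ≠ i} → V) × (Fin t → Option (Bool × Bool)))).card := by
      refine Finset.card_le_card_of_injOn
        (fun k => (fun j => k j, ChannelBit.encode t ((τ k).channel i))) (by simp) ?_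
      intro k hk k' hk' h
      simp only [Finset.coe_filter, Set.mem_ofPred_eq] at hk hk'
      simp only [Prod.mk.injEq] at h
      have hag : ∀ j, j ≠ i → k j = k' j := fun j hj => congrFun h.1 ⟨j, hj⟩
      have hc := ChannelBit.encode_injOn t hk.2 hk'.2 h.2
      obtain ⟨hr, y, hy, hg⟩ := hτ k hk.1
      obtain ⟨hr', y', hy', hg'⟩ := hτ k' hk'.1
      have hττ : τ k = τ k' :=
        hr.eq_of_channel_eq (i := i) (fun j hj => by simp [hag j hj]) hr' hy hy' hc
      rw [hττ, hy'] at hy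
      cases hy
      exact hgood i k k' hag _ hg hg'
    have hcard' : ((S.filter fun k => ((τ k).channel i).length ≤ t).card : ℝ) ≤
        (2 ^ m : ℝ) ^ (s - 1) * 5 ^ t := by
      rw [Finset.card_univ] at hcard
      simp only [Fintype.card_prod, Fintype.card_fun, hV, Fintype.card_option, Fintype.card_bool,
        Fintype.card_fin, Fintype.card_subtype_compl, Fintype.card_subtype_eq, ne_eq] at hcard
      exact_mod_cast hcard
    have hs : s - 1 + 1 = s := by have := i.2; omega
    calc _ ≤ (2 ^ m : ℝ) ^ (s - 1) * 5 ^ t := hcard'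
      _ ≤ (2 ^ m : ℝ) ^ (s - 1) * (5 / 8 * 2 ^ m) := by
        gcongr
        exact five_pow_le m hm
      _ = 5 / 8 * (2 ^ m : ℝ) ^ (s - 1 + 1) := by rw [pow_succ]; ring
      _ = 5 / 8 * N := by
        rw [hs, hN, Fintype.card_fun, hV, Fintype.card_fin]; push_cast; ring
  -- `0.98 - 5/8 = 0.355` exceeds `0.3`.
  have hlong : ∀ i, 0.3 * N * (t + 1) ≤ ∑ k ∈ S, (((τ k).channel i).length : ℝ) := by
    intro i
    have hsplit := Finset.card_filter_add_card_filter_not (s := S)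
      (fun k => ((τ k).channel i).length ≤ t)
    have hsplit' : ((S.filter fun k => ((τ k).channel i).length ≤ t).card : ℝ) +
        (S.filter fun k => ¬ ((τ k).channel i).length ≤ t).card = S.card := by
      exact_mod_cast hsplit
    have hs := hshort i
    calc 0.3 * N * (t + 1)
        ≤ (S.filter fun k => ¬ ((τ k).channel i).length ≤ t).card * (t + 1 : ℝ) := by
          gcongr
          linarith
      _ = ∑ k ∈ S.filter fun k => ¬ ((τ k).channel i).length ≤ t, (t + 1 : ℝ) := by
          rw [Finset.sum_const, nsmul_eq_mul]
      _ ≤ ∑ k ∈ S.filter fun k => ¬ ((τ k).channel i).length ≤ t,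
          (((τ k).channel i).length : ℝ) := by
          refine Finset.sum_le_sum fun k hk => ?_
          have := (Finset.mem_filter.1 hk).2
          exact_mod_cast not_le.1 this
      _ ≤ _ := Finset.sum_le_sum_of_subset_of_nonneg (Finset.filter_subset _ _)
          fun _ _ _ => by positivity
  have htotal : (s : ℝ) * (0.3 * N * (t + 1)) ≤ N * B := by
    calc (s : ℝ) * (0.3 * N * (t + 1)) = ∑ i : Fin s, 0.3 * N * (t + 1) := by simp
      _ ≤ ∑ i, ∑ k ∈ S, (((τ k).channel i).length : ℝ) := Finset.sum_le_sum fun i _ => hlong i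
      _ = ∑ k ∈ S, ((τ k).length : ℝ) := by
          rw [Finset.sum_comm]
          refine Finset.sum_congr rfl fun k _ => ?_
          exact_mod_cast (τ k).sum_length_channel
      _ ≤ ∑ k ∈ S, (B : ℝ) := Finset.sum_le_sum fun k hk => by
          exact_mod_cast hB k hk _ (hτ k hk).1
      _ = S.card * B := by simp
      _ ≤ N * B := by
          gcongr
          rw [hN]
          exact_mod_cast Finset.card_le_univ S
  have ht3 : (m : ℝ) ≤ 3 * (t + 1) := by
    have : m ≤ 3 * (t + 1) := by omega
    exact_mod_cast this
  have h1 : N * ((s : ℝ) * (0.3 * (t + 1))) ≤ N * B := by linarith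
  have h2 := le_of_mul_le_mul_left h1 hNpos
  have h3 : (s : ℝ) * m ≤ s * (3 * (t + 1)) := by gcongr
  linarith

/-- Fixing the random bits: if each of finitely many events has probability at least `p`, then some
outcome lies in at least a fraction `p` of them. -/
theorem exists_outcome_mem_many {Ω D : Type*} [MeasurableSpace Ω] [Fintype D]
    (μ : MeasureTheory.Measure Ω) [MeasureTheory.IsProbabilityMeasure μ] (E : D → Set Ω)
    (hE : ∀ k, MeasurableSet (E k)) {p : ℝ} (hp : ∀ k, p ≤ μ.real (E k)) :
    ∃ (ω : Ω) (S : Finset D), p * Fintype.card D ≤ S.card ∧ ∀ k ∈ S, ω ∈ E k := by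
  classical
  have hint : ∀ k ∈ Finset.univ, MeasureTheory.Integrable ((E k).indicator fun _ => (1 : ℝ)) μ :=
    fun k _ => (MeasureTheory.integrable_const 1).indicator (hE k)
  -- Some outcome attains at least the expected number of events.
  obtain ⟨ω, hω⟩ := MeasureTheory.exists_integral_le
    (MeasureTheory.integrable_finsetSum Finset.univ hint)
  refine ⟨ω, Finset.univ.filter fun k => ω ∈ E k, ?_, by simp⟩
  have h1 : ∑ k, (E k).indicator (fun _ => (1 : ℝ)) ω =
      (Finset.univ.filter fun k => ω ∈ E k).card := by
    simp [Set.indicator_apply]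
  rw [MeasureTheory.integral_finsetSum _ hint, h1] at hω
  refine le_trans ?_ hω
  calc p * Fintype.card D = ∑ _k : D, p := by simp [mul_comm]
    _ ≤ _ := Finset.sum_le_sum fun k _ => by
      rw [MeasureTheory.integral_indicator_const _ (hE k)]
      simpa using hp k

/-! ### Condition numbers -/

theorem norm_toLp_sq {ι : Type*} [Fintype ι] (v : ι → ℝ) :
    ‖WithLp.toLp 2 v‖ ^ 2 = ∑ r, v r ^ 2 := by
  rw [EuclideanSpace.real_norm_sq_eq]

open scoped Matrix.Norms.L2Operator in
/-- A matrix whose quadratic form lies between `lo` and `K² lo` has condition number at most `K`. -/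
theorem CondNumberLE.of_bounds {ι κ : Type*} [Fintype ι] [Fintype κ] [DecidableEq ι]
    [DecidableEq κ] (A : Matrix ι κ ℝ) {lo K : ℝ} (hlo : 0 < lo) (hK : 0 ≤ K)
    (h₁ : ∀ z, lo * ∑ j, z j ^ 2 ≤ ∑ r, (A.mulVec z) r ^ 2)
    (h₂ : ∀ z, ∑ r, (A.mulVec z) r ^ 2 ≤ K ^ 2 * lo * ∑ j, z j ^ 2) : CondNumberLE A K := by
  set M := A.transpose * A with hM
  have hMt : M.transpose = M := by simp [hM]
  have hunit : IsUnit M := by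
    rw [← Matrix.mulVec_injective_iff_isUnit]
    intro z w hzw
    have h0 : M.mulVec (z - w) = 0 := by rw [Matrix.mulVec_sub]; exact sub_eq_zero.2 hzw
    have h3 : ∑ r, (A.mulVec (z - w)) r ^ 2 = 0 := by
      have : ∑ r, (A.mulVec (z - w)) r ^ 2 = (A.mulVec (z - w)) ⬝ᵥ (A.mulVec (z - w)) := by
        simp [dotProduct, sq]
      rw [this, Matrix.dotProduct_mulVec, ← Matrix.mulVec_transpose, Matrix.mulVec_mulVec, ← hM,
        h0, zero_dotProduct]
    have h4 : ∑ j, (z - w) j ^ 2 = 0 := by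
      refine le_antisymm ?_ (Finset.sum_nonneg fun _ _ => sq_nonneg _)
      have := h₁ (z - w)
      rw [h3] at this
      by_contra hcon
      have := mul_pos hlo (not_le.1 hcon)
      linarith
    rw [Finset.sum_eq_zero_iff_of_nonneg fun _ _ => sq_nonneg _] at h4
    funext j
    have := pow_eq_zero_iff (two_ne_zero) |>.1 (h4 j (Finset.mem_univ j))
    simpa [sub_eq_zero] using this
  have hdet : IsUnit M.det := (Matrix.isUnit_iff_isUnit_det M).1 hunit
  set G := M⁻¹ * A.transpose with hG
  have hGA : G * A = 1 := by
    rw [hG, Matrix.mul_assoc, ← hM, Matrix.nonsing_inv_mul _ hdet]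
  have hAGt : (A * G).transpose = A * G := by
    rw [hG, Matrix.transpose_mul, Matrix.transpose_mul, Matrix.transpose_nonsing_inv, hMt,
      Matrix.transpose_transpose, Matrix.mul_assoc]
  refine ⟨G, ⟨?_, ?_, hAGt, ?_⟩, ?_⟩
  · rw [Matrix.mul_assoc, hGA, Matrix.mul_one]
  · rw [hGA, Matrix.one_mul]
  · rw [hGA, Matrix.transpose_one]
  · have hA : ‖A‖ ≤ K * √lo := by
      rw [Matrix.l2_opNorm_def]
      refine ContinuousLinearMap.opNorm_le_bound _ (by positivity) fun z => ?_
      refine (sq_le_sq₀ (norm_nonneg _) (by positivity)).1 ?_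
      rw [mul_pow, mul_pow, Real.sq_sqrt hlo.le]
      have := h₂ (WithLp.ofLp z)
      rw [← norm_toLp_sq, ← norm_toLp_sq] at this
      exact this
    have hGn : ‖G‖ ≤ (√lo)⁻¹ := by
      rw [Matrix.l2_opNorm_def]
      refine ContinuousLinearMap.opNorm_le_bound _ (by positivity) fun y => ?_
      -- `A * G` is an orthogonal projection, so `lo * ‖G y‖² ≤ ‖A G y‖² ≤ ‖y‖²`.
      have hP : ‖WithLp.toLp 2 ((A * G).mulVec (WithLp.ofLp y))‖ ≤ ‖y‖ := by
        set p := (A * G).mulVec (WithLp.ofLp y) with hp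
        have h5 : ‖WithLp.toLp 2 p‖ ^ 2 = inner ℝ (WithLp.toLp 2 p) y := by
          have : (A * G).mulVec p = p := by
            rw [hp, Matrix.mulVec_mulVec, Matrix.mul_assoc, ← Matrix.mul_assoc G, hGA,
              Matrix.one_mul]
          have h6 : p ⬝ᵥ p = (WithLp.ofLp y) ⬝ᵥ p := by
            calc p ⬝ᵥ p = p ⬝ᵥ (A * G).mulVec (WithLp.ofLp y) := rfl
              _ = (WithLp.ofLp y) ⬝ᵥ p := by
                rw [Matrix.dotProduct_mulVec, ← Matrix.mulVec_transpose, hAGt, this,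
                  dotProduct_comm]
          rw [norm_toLp_sq, EuclideanSpace.inner_eq_star_dotProduct]
          simpa [dotProduct, sq] using h6
        have h7 := real_inner_le_norm (WithLp.toLp 2 p) y
        rw [← h5, sq] at h7
        rcases (norm_nonneg (WithLp.toLp 2 p)).eq_or_lt with h8 | h8
        · rw [← h8]; exact norm_nonneg y
        · exact le_of_mul_le_mul_left h7 h8
      have h9 := h₁ (G.mulVec (WithLp.ofLp y))
      rw [Matrix.mulVec_mulVec, ← norm_toLp_sq, ← norm_toLp_sq] at h9
      have h10 : (√lo * ‖WithLp.toLp 2 (G.mulVec (WithLp.ofLp y))‖) ^ 2 ≤ ‖y‖ ^ 2 := by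
        rw [mul_pow, Real.sq_sqrt hlo.le]
        exact h9.trans (by gcongr)
      have h11 := (sq_le_sq₀ (by positivity) (norm_nonneg y)).1 h10
      rw [← div_eq_inv_mul, le_div_iff₀ (Real.sqrt_pos.2 hlo), mul_comm]
      exact h11
    calc ‖A‖ * ‖G‖ ≤ K * √lo * (√lo)⁻¹ := by gcongr
      _ = K := by
        have := (Real.sqrt_pos.2 hlo).ne'
        field_simp

/-! ### The hard instances -/

/-- Row labels of the block of one server: `d` data rows, `d` copies of the identity matrix, and one
further row. -/
abbrev HardRow (d : ℕ) : Type := (Option (Fin d) × Fin d) ⊕ Unit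

/-- The rows of `[A | b]` that a server holds; it encodes the numbers `t j`. -/
noncomputable def hardBlock {d : ℕ} (first : Prop) [Decidable first] (t : Fin d → ℝ) :
    HardRow d → (Fin d → ℝ) × ℝ
  | .inl (none, j) => (Pi.single j (t j), 0)
  -- The quadratic form of the row of ones is at most `d * ‖z‖²`; these copies supply a diagonal of
  -- the same order.
  | .inl (some _, j) => (Pi.single j 1, 0)
  | .inr _ => if first then (1, 1) else 0

/-- The input of a server with `m` rows, the rows outside the range of `e` being zero. -/
noncomputable def hardInput {d m : ℕ} (e : HardRow d ↪ Fin m) (first : Prop) [Decidable first]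
    (t : Fin d → ℝ) : ServerInput d m :=
  (Matrix.of fun r => (Function.extend e (hardBlock first t) 0 r).1,
    fun r => (Function.extend e (hardBlock first t) 0 r).2)

/-- Zero rows contribute nothing, so a server may have any number of surplus rows. -/
theorem sum_extend_zero {α β M : Type*} [Fintype α] [Fintype β] [Zero M] (e : α ↪ β)
    (g : α → M) (F : M → ℝ) (hF : F 0 = 0) :
    ∑ r, F (Function.extend e g 0 r) = ∑ a, F (g a) := by
  classical
  have h : ∀ r ∈ (Finset.univ : Finset β), r ∉ Finset.univ.map e →
      F (Function.extend e g 0 r) = 0 := by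
    intro r _ hr
    rw [Function.extend_apply' _ _ _ (by simpa using hr)]
    exact hF
  rw [← Finset.sum_subset (Finset.subset_univ _) h, Finset.sum_map]
  simp [e.injective.extend_apply]

theorem sum_hardBlock {d : ℕ} (first : Prop) [Decidable first] (t z : Fin d → ℝ) (c : ℝ) :
    ∑ ρ, ((hardBlock first t ρ).1 ⬝ᵥ z - c * (hardBlock first t ρ).2) ^ 2 =
      ∑ j, (d + t j ^ 2) * z j ^ 2 + if first then (∑ j, z j - c) ^ 2 else 0 := by
  rw [Fintype.sum_sum_type, Fintype.sum_prod_type, Fintype.sum_option]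
  simp only [hardBlock, single_dotProduct, one_mul, mul_zero, sub_zero, Finset.sum_const,
    Finset.card_univ, Fintype.card_fin, Fintype.card_unit, one_smul, nsmul_eq_mul]
  congr 1
  · rw [Finset.mul_sum, ← Finset.sum_add_distrib]
    exact Finset.sum_congr rfl fun j _ => by ring
  · split_ifs <;> simp [dotProduct]

section HardInstance

variable {s d : ℕ} {n : Fin s → ℕ} (e : ∀ i, HardRow d ↪ Fin (n i)) (i₀ : Fin s)
  (t : Fin s → Fin d → ℝ)

/-- The diagonal part of `AᵀA`. -/
noncomputable def hardWeight {s d : ℕ} (t : Fin s → Fin d → ℝ) (j : Fin d) : ℝ :=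
  s * d + ∑ i, t i j ^ 2

/-- The instance in which server `i` encodes the numbers `t i j`. -/
noncomputable def hardInstance (i : Fin s) : ServerInput d (n i) :=
  hardInput (e i) (i = i₀) (t i)

/-- The scalar `c` lets one computation serve three times: `c = 1` gives the residual, `c = 0` the
quadratic form of `AᵀA`, and `z = 0`, `c = 1` the norm of `b`. -/
theorem sum_hardInstance (z : Fin d → ℝ) (c : ℝ) :
    ∑ r, ((stackedMatrix (hardInstance e i₀ t)).mulVec z r -
        c * stackedVector (hardInstance e i₀ t) r) ^ 2 =
      ∑ j, hardWeight t j * z j ^ 2 + (∑ j, z j - c) ^ 2 := by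
  rw [Fintype.sum_sigma]
  have h : ∀ i, ∑ r, ((stackedMatrix (hardInstance e i₀ t)).mulVec z ⟨i, r⟩ -
        c * stackedVector (hardInstance e i₀ t) ⟨i, r⟩) ^ 2 =
      ∑ j, (d + t i j ^ 2) * z j ^ 2 + if i = i₀ then (∑ j, z j - c) ^ 2 else 0 := by
    intro i
    rw [← sum_hardBlock]
    exact sum_extend_zero (e i) (hardBlock (i = i₀) (t i))
      (fun v => (v.1 ⬝ᵥ z - c * v.2) ^ 2) (by simp)
  rw [Finset.sum_congr rfl fun i _ => h i, Finset.sum_add_distrib, Finset.sum_comm]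
  congr 1
  · refine Finset.sum_congr rfl fun j _ => ?_
    rw [← Finset.sum_mul, Finset.sum_add_distrib, hardWeight]
    simp
  · simp

theorem lsResidual_hardInstance_sq (z : Fin d → ℝ) :
    lsResidual (hardInstance e i₀ t) z ^ 2 =
      ∑ j, hardWeight t j * z j ^ 2 + (∑ j, z j - 1) ^ 2 := by
  rw [lsResidual, norm_toLp_sq, ← sum_hardInstance e i₀ t z 1]
  simp

variable {t}

theorem hardWeight_bounds (ht : ∀ i j, t i j ^ 2 ≤ 1) (j : Fin d) :
    (s * d : ℝ) ≤ hardWeight t j ∧ hardWeight t j ≤ s * d + s := by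
  have h0 : 0 ≤ ∑ i, t i j ^ 2 := Finset.sum_nonneg fun _ _ => sq_nonneg _
  have h1 : ∑ i, t i j ^ 2 ≤ ∑ _i : Fin s, (1 : ℝ) := Finset.sum_le_sum fun i _ => ht i j
  simp only [Finset.sum_const, Finset.card_univ, Fintype.card_fin, nsmul_eq_mul, mul_one] at h1
  rw [hardWeight]
  constructor <;> linarith

theorem condNumberLE_hardInstance (hd : 1 ≤ d) (ht : ∀ i j, t i j ^ 2 ≤ 1) :
    CondNumberLE (stackedMatrix (hardInstance e i₀ t)) 2 := by
  have hs : 1 ≤ s := by have := i₀.2; omega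
  have hs' : (1 : ℝ) ≤ s := by exact_mod_cast hs
  have hd' : (1 : ℝ) ≤ d := by exact_mod_cast hd
  have hform : ∀ z, ∑ r, ((stackedMatrix (hardInstance e i₀ t)).mulVec z r) ^ 2 =
      ∑ j, hardWeight t j * z j ^ 2 + (∑ j, z j) ^ 2 := fun z => by
    simpa using sum_hardInstance e i₀ t z 0
  refine CondNumberLE.of_bounds (lo := s * d) _ (by positivity) (by norm_num) ?_ ?_
  · intro z
    rw [hform, Finset.mul_sum]
    have : ∑ j, (s * d : ℝ) * z j ^ 2 ≤ ∑ j, hardWeight t j * z j ^ 2 :=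
      Finset.sum_le_sum fun j _ => by
        have := (hardWeight_bounds ht j).1
        gcongr
    have := sq_nonneg (∑ j, z j)
    linarith
  · intro z
    rw [hform]
    have h1 : ∑ j, hardWeight t j * z j ^ 2 ≤ (s * d + s) * ∑ j, z j ^ 2 := by
      rw [Finset.mul_sum]
      exact Finset.sum_le_sum fun j _ => by
        have := (hardWeight_bounds ht j).2
        gcongr
    have h2 : (∑ j, z j) ^ 2 ≤ d * ∑ j, z j ^ 2 := by
      simpa using sq_sum_le_card_mul_sum_sq (s := (Finset.univ : Finset (Fin d))) (f := z)
    have h3 : 0 ≤ ∑ j, z j ^ 2 := Finset.sum_nonneg fun _ _ => sq_nonneg _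
    have h4 : (s * d + s + d : ℝ) ≤ 2 ^ 2 * (s * d) := by nlinarith
    have h5 := mul_le_mul_of_nonneg_right h4 h3
    linarith

theorem HasBits.zero (L : ℕ) : HasBits L 0 :=
  ⟨0, by have : (1 : ℤ) ≤ 2 ^ L := one_le_pow₀ (by norm_num)
         omega, by positivity, by simp⟩

theorem HasBits.one (L : ℕ) : HasBits L 1 :=
  ⟨2 ^ L, by have : (1 : ℤ) ≤ 2 ^ L := one_le_pow₀ (by norm_num)
             omega, le_rfl, by simp⟩

theorem HasBits.div_two_pow {q L k : ℕ} (hq : q ≤ L) (hk : k ≤ 2 ^ q) :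
    HasBits L ((k : ℝ) / 2 ^ q) := by
  obtain ⟨l, rfl⟩ := Nat.exists_eq_add_of_le hq
  have h1 : (1 : ℤ) ≤ 2 ^ (q + l) := one_le_pow₀ (by norm_num)
  have h2 : (0 : ℤ) ≤ k * 2 ^ l := by positivity
  have h3 : (k : ℤ) * 2 ^ l ≤ 2 ^ (q + l) := by
    rw [pow_add]
    gcongr
    exact_mod_cast hk
  refine ⟨k * 2 ^ l, by omega, h3, ?_⟩
  push_cast
  rw [pow_add]
  field_simp

theorem isRegressionInstance_hardInstance {L : ℕ} (hd : 1 ≤ d) (ht : ∀ i j, t i j ^ 2 ≤ 1)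
    (hbits : ∀ i j, HasBits L (t i j)) :
    IsRegressionInstance L 2 (hardInstance e i₀ t) := by
  have hrow : ∀ i (ρ : HardRow d), (∀ k, HasBits L ((hardBlock (i = i₀) (t i) ρ).1 k)) ∧
      HasBits L (hardBlock (i = i₀) (t i) ρ).2 := by
    rintro i (⟨_ | _, j⟩ | _)
    · refine ⟨fun k => ?_, HasBits.zero L⟩
      rcases eq_or_ne k j with rfl | hk
      · simpa [hardBlock] using hbits i k
      · simpa [hardBlock, hk] using HasBits.zero L
    · refine ⟨fun k => ?_, HasBits.zero L⟩
      rcases eq_or_ne k j with rfl | hk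
      · simpa [hardBlock] using HasBits.one L
      · simpa [hardBlock, hk] using HasBits.zero L
    · by_cases hi : i = i₀
      · simpa [hardBlock, hi] using ⟨fun _ => HasBits.one L, HasBits.one L⟩
      · simpa [hardBlock, hi] using ⟨fun _ => HasBits.zero L, HasBits.zero L⟩
  have hext : ∀ i r, (∀ k, HasBits L ((Function.extend (e i) (hardBlock (i = i₀) (t i)) 0 r).1 k)) ∧
      HasBits L (Function.extend (e i) (hardBlock (i = i₀) (t i)) 0 r).2 := by
    intro i r
    by_cases hr : ∃ ρ, e i ρ = r
    · obtain ⟨ρ, rfl⟩ := hr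
      rw [(e i).injective.extend_apply]
      exact hrow i ρ
    · rw [Function.extend_apply' _ _ _ hr]
      exact ⟨fun _ => HasBits.zero L, HasBits.zero L⟩
  refine ⟨fun r k => (hext r.1 r.2).1 k, fun r => (hext r.1 r.2).2, ?_,
    condNumberLE_hardInstance e i₀ hd ht⟩
  have h := sum_hardInstance e i₀ t 0 1
  rw [← sq_eq_sq₀ (norm_nonneg _) zero_le_one, norm_toLp_sq]
  simpa using h

end HardInstance

/-! ### Approximate minimizers determine the weights -/

/-- An approximate minimizer of `z ↦ (∑ Λ_j z_j² + (∑ z_j - 1)²)^(1/2)` has a small gradient. -/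
theorem gradient_sq_le {d : ℕ} {Λ : Fin d → ℝ} (hΛ : ∀ j, 0 ≤ Λ j) {R : (Fin d → ℝ) → ℝ}
    (hR0 : ∀ w, 0 ≤ R w)
    (hR : ∀ w, R w ^ 2 = ∑ j, Λ j * w j ^ 2 + (∑ j, w j - 1) ^ 2) {ε : ℝ} (hε0 : 0 ≤ ε)
    (hε1 : ε ≤ 1) {z : Fin d → ℝ} (hz : ∀ w, R z ≤ ε + R w) (j : Fin d) :
    (Λ j * z j + ∑ k, z k - 1) ^ 2 ≤ 4 * ε * (Λ j + 1) := by
  set g := Λ j * z j + ∑ k, z k - 1 with hg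
  have hpos : 0 < Λ j + 1 := by linarith [hΛ j]
  -- The exact line-search step along coordinate `j`; it lowers `R²` by `g² / (Λ j + 1)`.
  set τ := g / (Λ j + 1) with hτ
  have hτg : τ * (Λ j + 1) = g := by rw [hτ]; field_simp
  have hw : R (z - Pi.single j τ) ^ 2 = R z ^ 2 - g * τ := by
    rw [hR, hR]
    have h1 : ∑ k, Λ k * (z - Pi.single j τ : Fin d → ℝ) k ^ 2 =
        ∑ k, Λ k * z k ^ 2 - 2 * τ * (Λ j * z j) + Λ j * τ ^ 2 := by
      have h3 : ∀ k, Λ k * (z - Pi.single j τ : Fin d → ℝ) k ^ 2 = Λ k * z k ^ 2 +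
          if k = j then Λ k * (τ ^ 2 - 2 * τ * z k) else 0 := by
        intro k
        rcases eq_or_ne k j with rfl | hk
        · simp only [Pi.sub_apply, Pi.single_eq_same, if_true]; ring
        · simp [hk]
      simp only [h3, Finset.sum_add_distrib, Finset.sum_ite_eq', Finset.mem_univ, if_true]
      ring
    have h2 : ∑ k, (z - Pi.single j τ : Fin d → ℝ) k = ∑ k, z k - τ := by
      simp [Finset.sum_sub_distrib]
    rw [h1, h2]
    linear_combination (τ : ℝ) * hτg - 2 * τ * hg
  have hR1 : R z ≤ 2 := by
    have h0 : R 0 ^ 2 = 1 := by rw [hR]; simp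
    have h1 : R 0 = 1 := by nlinarith [hR0 0]
    linarith [hz 0]
  have hgt : g * τ * (Λ j + 1) = g ^ 2 := by rw [mul_assoc, hτg, sq]
  -- Near-optimality allows `R²` to drop by at most `2 ε R z ≤ 4 ε`, or by `ε² ≤ ε` if `R z ≤ ε`.
  have hbound : g * τ ≤ 4 * ε := by
    have h1 := hz (z - Pi.single j τ)
    rcases le_total (R z) ε with h | h
    · nlinarith [hR0 z, sq_nonneg (R (z - Pi.single j τ))]
    · have h2 : (R z - ε) ^ 2 ≤ R (z - Pi.single j τ) ^ 2 := by
        apply pow_le_pow_left₀ <;> linarith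
      nlinarith
  rw [← hgt]
  gcongr

/-- Where the gradient is small, all coordinates are bounded away from zero. -/
theorem one_le_weight_mul {d : ℕ} {Λ : Fin d → ℝ} (hd : ∀ j, (d : ℝ) ≤ Λ j) {z : Fin d → ℝ}
    (hg : ∀ j, |Λ j * z j + ∑ k, z k - 1| ≤ 1 / 6) (j : Fin d) : 1 ≤ 4 * (Λ j * z j) := by
  have hdpos : (0 : ℝ) < d := by exact_mod_cast j.pos
  -- Otherwise `Λ k * z k ≤ 7/6 - 7/12 = 7/12` for all `k`, and `d ≤ Λ k` forces the sum back below
  -- `7/12`. Then `Λ j * z j ≥ 1 - 7/12 - 1/6 = 1/4`.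
  have hS : ∑ k, z k ≤ 7 / 12 := by
    by_contra hcon
    have h1 : ∀ k, z k ≤ 7 / 12 / d := by
      intro k
      have h2 := (abs_le.1 (hg k)).2
      rw [le_div_iff₀ hdpos]
      rcases le_total (z k) 0 with h | h
      · nlinarith
      · nlinarith [hd k]
    have h3 : ∑ k, z k ≤ ∑ _k : Fin d, 7 / 12 / (d : ℝ) := Finset.sum_le_sum fun k _ => h1 k
    simp only [Finset.sum_const, Finset.card_univ, Fintype.card_fin, nsmul_eq_mul] at h3
    rw [mul_div_cancel₀ _ hdpos.ne'] at h3
    exact hcon h3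
  have := (abs_le.1 (hg j)).1
  linarith

/-! ### Decoding -/

/-- The numbers `k / 2 ^ q` encoded by the servers. -/
noncomputable def dataValue {s d q : ℕ} (k : Fin s → Fin d → Fin (2 ^ q)) (i : Fin s)
    (j : Fin d) : ℝ :=
  (k i j : ℕ) / 2 ^ q

theorem dataValue_sq_le_one {s d q : ℕ} (k : Fin s → Fin d → Fin (2 ^ q)) (i : Fin s)
    (j : Fin d) : dataValue k i j ^ 2 ≤ 1 := by
  have h : ((k i j : ℕ) : ℝ) ≤ 2 ^ q := by exact_mod_cast (k i j).2.le
  have h1 : dataValue k i j ≤ 1 := (div_le_one (by positivity)).2 h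
  exact pow_le_one₀ (by unfold dataValue; positivity) h1

/-- The weights see the data only through squares, which separate nonnegative integers. -/
theorem one_le_abs_sq_sub_sq {a b : ℕ} (h : a ≠ b) : (1 : ℝ) ≤ |(a : ℝ) ^ 2 - (b : ℝ) ^ 2| := by
  have h1 : (a : ℤ) ^ 2 - (b : ℤ) ^ 2 ≠ 0 := by
    intro h0
    refine h (Nat.pow_left_injective (n := 2) two_ne_zero ?_)
    have : (a : ℤ) ^ 2 = (b : ℤ) ^ 2 := by linarith
    exact_mod_cast this
  exact_mod_cast Int.one_le_abs h1

/-- If the accuracy is high enough, no vector solves two instances that differ at one server. -/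
theorem data_eq_of_common_solution {s d q : ℕ} {n : Fin s → ℕ}
    (e : ∀ i, HardRow d ↪ Fin (n i)) (i₀ : Fin s) {ε : ℝ} (hε : 0 < ε)
    (hacc : 16 * ((s : ℝ) + d) ^ 3 * √ε * 4 ^ q < 1) {k k' : Fin s → Fin d → Fin (2 ^ q)}
    {i : Fin s} (hk : ∀ i', i' ≠ i → k i' = k' i') {z : Fin d → ℝ}
    (hz : IsApproxLeastSquares (hardInstance e i₀ (dataValue k)) ε z)
    (hz' : IsApproxLeastSquares (hardInstance e i₀ (dataValue k')) ε z) : k = k' := by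
  funext i' j
  rcases ne_or_eq i' i with hi' | rfl
  · rw [hk i' hi']
  by_contra hne
  have hs : (1 : ℝ) ≤ s := by exact_mod_cast i₀.pos
  have hd : (1 : ℝ) ≤ d := by exact_mod_cast j.pos
  set N : ℝ := s + d with hN
  have hN2 : 2 ≤ N := by linarith
  have hδ : 0 < √ε := Real.sqrt_pos.2 hε
  have hδε : √ε ^ 2 = ε := Real.sq_sqrt hε.le
  have hq : (1 : ℝ) ≤ 4 ^ q := one_le_pow₀ (by norm_num)
  have hacc₁ : 16 * N ^ 3 * √ε < 1 := by
    have : 16 * N ^ 3 * √ε * 1 ≤ 16 * N ^ 3 * √ε * 4 ^ q := by gcongr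
    linarith
  have hη : 2 * N * √ε ≤ 1 / 6 := by
    have h4 : (4 : ℝ) ≤ N ^ 2 := by nlinarith
    have : 4 * (N * √ε) ≤ N ^ 2 * (N * √ε) := by gcongr
    nlinarith
  have hε1 : ε ≤ 1 := by
    have : √ε ≤ 1 := by nlinarith
    rw [← hδε]
    exact pow_le_one₀ hδ.le this
  have hwN : ∀ {t : Fin s → Fin d → ℝ}, (∀ i j, t i j ^ 2 ≤ 1) →
      ∀ j, hardWeight t j + 1 ≤ N ^ 2 := by
    intro t ht j
    have := (hardWeight_bounds ht j).2
    nlinarith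
  have hgrad : ∀ k : Fin s → Fin d → Fin (2 ^ q),
      IsApproxLeastSquares (hardInstance e i₀ (dataValue k)) ε z →
      ∀ j, |hardWeight (dataValue k) j * z j + ∑ l, z l - 1| ≤ 2 * N * √ε := by
    intro k hz j
    have hw : ∀ j, 0 ≤ hardWeight (dataValue k) j := fun j =>
      le_trans (by positivity) (hardWeight_bounds (dataValue_sq_le_one k) j).1
    have h := gradient_sq_le hw (fun w => norm_nonneg _)
      (lsResidual_hardInstance_sq e i₀ (dataValue k)) hε.le hε1 hz j
    refine abs_le_of_sq_le_sq (h.trans ?_) (by positivity)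
    rw [mul_pow, mul_pow, hδε]
    have := mul_le_mul_of_nonneg_left (hwN (dataValue_sq_le_one k) j) hε.le
    linarith
  have hg := hgrad k hz j
  have hg' := hgrad k' hz' j
  have hpos := one_le_weight_mul (z := z) (Λ := hardWeight (dataValue k))
    (fun j => le_trans (by nlinarith) (hardWeight_bounds (dataValue_sq_le_one k) j).1)
    (fun j => (hgrad k hz j).trans hη) j
  have hzpos : 0 < z j := by
    have := (hardWeight_bounds (dataValue_sq_le_one k) j).1
    have : 0 < hardWeight (dataValue k) j := lt_of_lt_of_le (by positivity) this
    by_contra hcon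
    nlinarith
  have hzN : 1 ≤ 4 * (N ^ 2 * z j) := by
    have := hwN (dataValue_sq_le_one k) j
    nlinarith
  have hdiff : hardWeight (dataValue k) j - hardWeight (dataValue k') j =
      (((k i' j : ℕ) : ℝ) ^ 2 - ((k' i' j : ℕ) : ℝ) ^ 2) / 4 ^ q := by
    have h1 : hardWeight (dataValue k) j - hardWeight (dataValue k') j =
        ∑ l, (dataValue k l j ^ 2 - dataValue k' l j ^ 2) := by
      rw [hardWeight, hardWeight, Finset.sum_sub_distrib]; ring
    rw [h1, Finset.sum_eq_single i']
    · have : (4 : ℝ) ^ q = (2 ^ q) ^ 2 := by rw [← pow_mul, mul_comm, pow_mul]; norm_num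
      rw [dataValue, dataValue, div_pow, div_pow, this, sub_div]
    · intro l _ hl
      rw [dataValue, dataValue, hk l hl, sub_self]
    · simp
  have hgap : 1 ≤ |hardWeight (dataValue k) j - hardWeight (dataValue k') j| * 4 ^ q := by
    rw [hdiff, abs_div, abs_of_pos (show (0 : ℝ) < 4 ^ q by positivity),
      div_mul_cancel₀ _ (by positivity)]
    exact one_le_abs_sq_sub_sq fun h => hne (Fin.ext h)
  -- Both gradients are taken at the same `z`, so `∑ l, z l - 1` cancels in their difference.
  have hprod : |hardWeight (dataValue k) j - hardWeight (dataValue k') j| * z j ≤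
      4 * N * √ε := by
    nth_rewrite 1 [← abs_of_pos hzpos]
    rw [← abs_mul]
    rw [abs_le] at hg hg' ⊢
    constructor <;> linarith [hg.1, hg.2, hg'.1, hg'.2]
  set D := |hardWeight (dataValue k) j - hardWeight (dataValue k') j|
  have : (1 : ℝ) ≤ 16 * N ^ 3 * √ε * 4 ^ q :=
    calc (1 : ℝ) ≤ D * 4 ^ q := hgap
      _ ≤ D * 4 ^ q * (4 * (N ^ 2 * z j)) := le_mul_of_one_le_right (by linarith) hzN
      _ = 4 * N ^ 2 * 4 ^ q * (D * z j) := by ring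
      _ ≤ 4 * N ^ 2 * 4 ^ q * (4 * N * √ε) := by gcongr
      _ = 16 * N ^ 3 * √ε * 4 ^ q := by ring
  linarith

/-! ### Choice of parameters and conclusion -/

/-- The fourth power of the left side is `2 ^ 16 * N ^ 12 * ε² * 256 ^ q`. One factor `ε` pays for
`256 ^ q`, the other for `2 ^ 17 * N ^ 12 ≤ N ^ 29`; the spare factor 2 makes the inequality strict.
-/
theorem accuracy_bound {N ε : ℝ} (hN : 2 ≤ N) (hε : 0 < ε) (hεN : ε * N ^ 29 ≤ 1) {q : ℕ}
    (hq : 8 * (q : ℝ) ≤ Real.logb 2 ε⁻¹) : 16 * N ^ 3 * √ε * 4 ^ q < 1 := by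
  have hq' : ε * 256 ^ q ≤ 1 := by
    have h1 : (2 : ℝ) ^ (8 * (q : ℝ)) ≤ ε⁻¹ :=
      (Real.le_logb_iff_rpow_le (by norm_num) (by positivity)).1 hq
    have h2 : (2 : ℝ) ^ (8 * (q : ℝ)) = 256 ^ q := by
      rw [Real.rpow_mul (by norm_num), Real.rpow_natCast]; norm_num
    rw [h2] at h1
    calc ε * 256 ^ q ≤ ε * ε⁻¹ := by gcongr
      _ = 1 := mul_inv_cancel₀ hε.ne'
  by_contra hcon
  have h1 : (1 : ℝ) ≤ (16 * N ^ 3 * √ε * 4 ^ q) ^ 4 := one_le_pow₀ (not_lt.1 hcon)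
  have h2 : (16 * N ^ 3 * √ε * 4 ^ q) ^ 4 = 65536 * N ^ 12 * ε * (ε * 256 ^ q) := by
    have h3 : √ε ^ 4 = ε ^ 2 := by
      rw [show 4 = 2 * 2 by norm_num, pow_mul, Real.sq_sqrt hε.le]
    have h4 : ((4 : ℝ) ^ q) ^ 4 = 256 ^ q := by
      rw [← pow_mul, mul_comm, pow_mul]; norm_num
    rw [mul_pow, mul_pow, mul_pow, h3, h4]
    ring
  have h5 : 65536 * N ^ 12 * ε * (ε * 256 ^ q) ≤ 65536 * N ^ 12 * ε * 1 := by gcongr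
  have h6 : (2 : ℝ) ^ 17 ≤ N ^ 17 := by gcongr
  have h7 : 2 ^ 17 * N ^ 12 * ε ≤ N ^ 17 * N ^ 12 * ε := by gcongr
  have h8 : N ^ 17 * N ^ 12 * ε = ε * N ^ 29 := by ring
  have h9 : 0 < N ^ 12 * ε := by positivity
  nlinarith

theorem card_hardRow (d : ℕ) : Fintype.card (HardRow d) = (d + 1) * d + 1 := by
  simp [HardRow]

theorem mainTheorem12 :
    ∃ (c : ℝ) (C : ℕ) (K : ℝ), 0 < c ∧
      ∀ (s d L : ℕ) (ε : ℝ), 0 < ε → ε * ((s : ℝ) + d) ^ C ≤ 1 →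
        ∃ n₀ : Fin s → ℕ, ∑ i, n₀ i ≤ (s + d) ^ C ∧
          ∀ n : Fin s → ℕ, (∀ i, n₀ i ≤ n i) →
            ∀ (Ω : Type*) [MeasurableSpace Ω] (μ : MeasureTheory.Measure Ω)
              [MeasureTheory.IsProbabilityMeasure μ]
              (P : Ω → CoordProtocol s (fun i => ServerInput d (n i)) (Fin d → ℝ)) (B : ℕ),
              (∀ x, IsRegressionInstance L K x →
                CoordProtocol.SucceedsWithProb μ P x (IsApproxLeastSquares x ε) 0.98) →
              (∀ x, IsRegressionInstance L K x → ∀ ω, (P ω).UsesAtMost x B) →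
              c * (s * d * min (Real.logb 2 ε⁻¹) L) ≤ B := by
  -- `160 = 10 * 16`: the 10 is lost in `CoordProtocol.le_communication`, the 16 in `hqmin`. The
  -- exponent 29 comes from `accuracy_bound`.
  refine ⟨1 / 160, 29, 2, by norm_num, fun s d L ε hε hεC => ?_⟩
  rcases Nat.eq_zero_or_pos s with rfl | hs
  · exact ⟨0, by simp, fun n _ Ω _ μ _ P B _ _ => by simp⟩
  rcases Nat.eq_zero_or_pos d with rfl | hd
  · exact ⟨0, by simp, fun n _ Ω _ μ _ P B _ _ => by simp⟩
  refine ⟨fun _ => (d + 1) * d + 1, ?_, fun n hn Ω _ μ _ P B hP hPB => ?_⟩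
  · simp only [Finset.sum_const, Finset.card_univ, Fintype.card_fin, smul_eq_mul]
    calc s * ((d + 1) * d + 1) ≤ (s + d) * ((s + d) * (s + d)) := by
          gcongr
          · omega
          · nlinarith
      _ = (s + d) ^ 3 := by ring
      _ ≤ (s + d) ^ 29 := Nat.pow_le_pow_right (by omega) (by norm_num)
  have hN : (2 : ℝ) ≤ s + d := by
    have : 2 ≤ s + d := by omega
    exact_mod_cast this
  have hlog : 29 ≤ Real.logb 2 ε⁻¹ := by
    rw [Real.le_logb_iff_rpow_le (by norm_num) (by positivity), le_inv_comm₀ (by positivity) hε,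
      ← one_div, le_div_iff₀ (by positivity)]
    refine le_trans ?_ hεC
    gcongr
    rw [show (29 : ℝ) = (29 : ℕ) by norm_num, Real.rpow_natCast]
    gcongr
  rcases Nat.eq_zero_or_pos L with rfl | hL
  · rw [min_eq_right (by rw [Nat.cast_zero]; linarith)]
    simp
  set ℓ := Real.logb 2 ε⁻¹ with hℓ
  set q := min L ⌊ℓ / 8⌋₊ with hq
  have hfloor := Nat.floor_le (a := ℓ / 8) (by positivity)
  have hfloor' := Nat.lt_floor_add_one (ℓ / 8)
  have hq1 : 1 ≤ q := le_min hL (Nat.le_floor (by push_cast; linarith))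
  have hqL : q ≤ L := min_le_left _ _
  have hqℓ : 8 * (q : ℝ) ≤ ℓ := by
    have : (q : ℝ) ≤ ⌊ℓ / 8⌋₊ := by exact_mod_cast min_le_right _ _
    linarith
  -- As `ℓ ≥ 29`, rounding `ℓ / 8` down loses at most a factor 2.
  have hqmin : min ℓ L ≤ 16 * q := by
    rcases min_choice L ⌊ℓ / 8⌋₊ with h | h
    · rw [hq, h]
      have := min_le_right ℓ (L : ℝ)
      have := (Nat.cast_nonneg L : (0 : ℝ) ≤ L)
      linarith
    · rw [hq, h]
      have := min_le_left ℓ (L : ℝ)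
      linarith
  have hacc := accuracy_bound hN hε hεC hqℓ
  have he : ∀ i, Nonempty (HardRow d ↪ Fin (n i)) := fun i =>
    Function.Embedding.nonempty_of_card_le (by rw [card_hardRow, Fintype.card_fin]; exact hn i)
  let e : ∀ i, HardRow d ↪ Fin (n i) := fun i => (he i).some
  let i₀ : Fin s := ⟨0, hs⟩
  have hinst : ∀ k : Fin s → Fin d → Fin (2 ^ q),
      IsRegressionInstance L 2 (hardInstance e i₀ (dataValue k)) := fun k =>
    isRegressionInstance_hardInstance e i₀ hd (dataValue_sq_le_one k)
      fun i j => HasBits.div_two_pow hqL (k i j).2.le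
  choose E hEm hEp hE using fun k => hP _ (hinst k)
  obtain ⟨ω, S, hS, hSE⟩ := exists_outcome_mem_many μ E hEm hEp
  have hmain := CoordProtocol.le_communication (m := q * d) (V := Fin d → Fin (2 ^ q))
    (Nat.mul_pos hq1 hd) (by simp [pow_mul]) (P ω)
    (fun i v => hardInput (e i) (i = i₀) fun j => ((v j : ℕ) : ℝ) / 2 ^ q)
    (fun k y => IsApproxLeastSquares (hardInstance e i₀ (dataValue k)) ε y)
    (fun i k k' hk y hy hy' => data_eq_of_common_solution e i₀ hε hacc hk hy hy')
    S B hS (fun k hk => hE k ω (hSE k hk)) (fun k _ => hPB _ (hinst k) ω)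
  have h1 : (s * d : ℝ) * min ℓ L ≤ s * d * (16 * q) := by gcongr
  push_cast at hmain
  linarith
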